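/- Let $\mathbb{D}=\{z\in\mathbb{C}:|z|<1\}$ and let $\mathcal{S}$ be the class of analytic univalent functions $f$ on $\mathbb{D}$ with $f(0)=0$, $f'(0)=1$. For analytic $p,\varphi$ on $\mathbb{D}$, write $p\prec\varphi$ if $p=\varphi\circ\omega$ for some analytic $\omega:\mathbb{D}\to\mathbb{D}$ with $\omega(0)=0$. Let $\mathcal{S}^*(\varphi)$ be the class of all $f\in\mathcal{S}$ with $zf'(z)/f(z)\prec\varphi(z)$, where $zf'(z)/f(z)$ is given its limit value $1$ at $z=0$, and let $\mathcal{S}^*_{car}=\mathcal{S}^*(1+z+z^2/2)$. The $\mathcal{S}^*_{car}$-radius of a class $\mathcal{M}\subset\mathcal{S}$ is the largest $R\in(0,1]$ such that $z\mapsto f(rz)/r$ belongs to $\mathcal{S}^*_{car}$ for all $f\in\mathcal{M}$ and all $0<r\le R$. It is called sharp if there is a single $f\in\mathcal{M}$ such that $z\mapsto f(rz)/r$ is not in $\mathcal{S}^*_{car}$ for any $r\in(R,1]$. All square roots are principal. The following are the $\mathcal{S}^*_{car}$-radii of the indicated classes, and all of them are sharp. (a) $\mathcal{S}^*(\sqrt{1+cz})$,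 $\tfrac34<c\le1$: $\;r_1=\dfrac{3}{4c}$. (b) $\mathcal{S}^*_L(\alpha)=\mathcal{S}^*(\alpha+(1-\alpha)\sqrt{1+z})$, $0\le\alpha<\tfrac12$: $\;r_2=\dfrac{3-4\alpha}{4(1-\alpha)^2}$. (c) $\mathcal{S}^*_e(\alpha)=\mathcal{S}^*(\alpha+(1-\alpha)e^z)$, $0\le\alpha<\dfrac{e-2}{2(e-1)}$: $\;r_3=\log\left(\dfrac{2(1-\alpha)}{1-2\alpha}\right)$. (d) $\mathcal{S}^*_{RL}=\mathcal{S}^*\left(\sqrt2-(\sqrt2-1)\sqrt{\dfrac{1-z}{1+2(\sqrt2-1)z}}\right)$: $\;r_4=\dfrac{39+17\sqrt2}{82}$. (e) $\mathcal{S}^*_C=\mathcal{S}^*(1+4z/3+2z^2/3)$: $\;r_5=\tfrac12$. (f) $\mathcal{S}^*_{lim}=\mathcal{S}^*(1+\sqrt2\,z+z^2/2)$: $\;r_6=\sqrt2-1$. (g) The crescent class $\mathcal{S}^*(z+\sqrt{1+z^2})$: $\;r_7=\tfrac34$. (h) $\mathcal{S}^*_{sin}=\mathcal{S}^*(1+\sin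 z)$: $\;r_8=\arcsin\left(\tfrac12\right)$. (i) $\mathcal{S}^*_{ne}=\mathcal{S}^*(1+z-z^3/3)$: $\;r_9$, the smallest root of $2r^3-6r+3=0$ in $(0,1)$; it satisfies $|r_9-0.557875|<10^{-6}$. -/

import Mathlib

open Complex

noncomputable section

namespace CarRadius

/-- The open unit disk. -/
def unitDisk : Set ℂ := Metric.ball 0 1

/-- The class `𝒮` of normalized univalent functions: `f` is holomorphic and injective on the unit
disk with `f 0 = 0` and `f' 0 = 1`. Values outside the disk are irrelevant. -/
structure IsNormalizedUnivalent (f : ℂ → ℂ) : Prop where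
  differentiableOn : DifferentiableOn ℂ f unitDisk
  map_zero : f 0 = 0
  deriv_zero : deriv f 0 = 1
  injOn : Set.InjOn f unitDisk

/-- Subordination `p ≺ φ` on the unit disk: `p = φ ∘ ω` on the disk for some holomorphic self-map
`ω` of the disk fixing the origin. -/
def Subordinate (p φ : ℂ → ℂ) : Prop :=
  ∃ ω : ℂ → ℂ, DifferentiableOn ℂ ω unitDisk ∧ Set.MapsTo ω unitDisk unitDisk ∧ ω 0 = 0 ∧
    ∀ z ∈ unitDisk, p z = φ (ω z)

/-- The function `z f'(z) / f(z)`, with its removable singularity at `0` filled in (for a function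
in `𝒮` the value there is `1`, and `f` has no other zero in the disk). -/
def starQuotient (f : ℂ → ℂ) (z : ℂ) : ℂ :=
  if z = 0 then 1 else z * deriv f z / f z

/-- The Ma–Minda class `𝒮*(φ)`. -/
def starClass (φ : ℂ → ℂ) : Set (ℂ → ℂ) :=
  {f | IsNormalizedUnivalent f ∧ Subordinate (starQuotient f) φ}

/-- The cardioid function `φ_car`. -/
def phiCar (z : ℂ) : ℂ := 1 + z + z ^ 2 / 2

/-- The class `𝒮*_car`. -/
def starCar : Set (ℂ → ℂ) := starClass phiCar

/-- The principal square root. -/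
def csqrt (z : ℂ) : ℂ := z ^ (1 / 2 : ℂ)

/-- `√(1 + c z)`, right loop of a Cassinian oval. -/
def psiCassini (c : ℝ) (z : ℂ) : ℂ := csqrt (1 + c * z)

/-- `α + (1 - α) √(1 + z)`. -/
def psiL (α : ℝ) (z : ℂ) : ℂ := α + (1 - α) * csqrt (1 + z)

/-- `α + (1 - α) e^z`. -/
def psiE (α : ℝ) (z : ℂ) : ℂ := α + (1 - α) * exp z

/-- `√2 - (√2 - 1) √((1 - z) / (1 + 2 (√2 - 1) z))`. -/
def psiRL (z : ℂ) : ℂ :=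
  (√2 : ℝ) - ((√2 : ℝ) - 1) * csqrt ((1 - z) / (1 + 2 * ((√2 : ℝ) - 1) * z))

/-- `1 + 4 z / 3 + 2 z² / 3`. -/
def psiC (z : ℂ) : ℂ := 1 + 4 * z / 3 + 2 * z ^ 2 / 3

/-- `1 + √2 z + z² / 2`. -/
def psiLim (z : ℂ) : ℂ := 1 + (√2 : ℝ) * z + z ^ 2 / 2

/-- `z + √(1 + z²)`. -/
def psiCrescent (z : ℂ) : ℂ := z + csqrt (1 + z ^ 2)

/-- `1 + sin z`. -/
def psiSin (z : ℂ) : ℂ := 1 + sin z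

/-- `1 + z - z³ / 3`. -/
def psiNe (z : ℂ) : ℂ := 1 + z - z ^ 3 / 3

/-- The dilation `z ↦ f (r z) / r`. -/
def dilate (f : ℂ → ℂ) (r : ℝ) (z : ℂ) : ℂ := f (r * z) / r

/-- `R` is the `N`-radius of the class `M`: the largest `R ∈ (0, 1]` such that
`z ↦ f (r z) / r` belongs to `N` for all `f ∈ M` and all `0 < r ≤ R`. -/
def IsClassRadius (N M : Set (ℂ → ℂ)) (R : ℝ) : Prop :=
  IsGreatest
    {R : ℝ | 0 < R ∧ R ≤ 1 ∧ ∀ f ∈ M, ∀ r : ℝ, 0 < r → r ≤ R → dilate f r ∈ N} R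

/-- `R` is the `N`-radius of `M`, and it is sharp: a single extremal function in `M` shows that
it cannot be enlarged. -/
def IsSharpRadius (N M : Set (ℂ → ℂ)) (R : ℝ) : Prop :=
  IsClassRadius N M R ∧ ∃ f ∈ M, ∀ r : ℝ, R < r → r ≤ 1 → dilate f r ∉ N

end CarRadius

end

/-!
For each `ψ` in the list, `zf'/f = ψ` has a univalent solution `f`: since `Re ψ > 0`, writing
`f z = z exp (h z)` and passing to the coordinate `log z` on the left half-plane turns `ψ` into a
derivative of positive real part. Subordination to `ψ` and the Schwarz lemma confine `zf'/f` on
`|z| < R` to `ψ({|z| < R})`. So the radius is the largest `R` for which this image lies in the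
cardioid domain `φ_car(𝔻)`. In all nine cases `ψ` touches its boundary first at `-R`, in the cusp
`ψ (-R) = 1 / 2`. That `ψ({|z| < R})` lies in the cardioid domain is read off from the explicit
inverse `w ↦ √(2 w - 1) - 1` of `φ_car`, mostly by fitting the image into a half-disk or a disk
inside the domain.
-/

namespace CarRadius

open Set

lemma mem_unitDisk {z : ℂ} : z ∈ unitDisk ↔ ‖z‖ < 1 := mem_ball_zero_iff

lemma zero_mem_unitDisk : (0 : ℂ) ∈ unitDisk := Metric.mem_ball_self one_pos

lemma sq_norm_eq (z : ℂ) : ‖z‖ ^ 2 = z.re ^ 2 + z.im ^ 2 := by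
  rw [Complex.sq_norm, normSq_apply, sq, sq]

lemma re_sq_add_im_sq_lt {z : ℂ} {R : ℝ} (hz : ‖z‖ < R) : z.re ^ 2 + z.im ^ 2 < R ^ 2 := by
  rw [← sq_norm_eq]
  exact pow_lt_pow_left₀ hz (norm_nonneg z) two_ne_zero

/-! ### Univalent solutions of `z f' / f = p` -/

/-- The Carathéodory class of holomorphic functions on the unit disk with positive real part,
normalized by `p 0 = 1`. -/
structure IsCaratheodory (p : ℂ → ℂ) : Prop where
  differentiableOn : DifferentiableOn ℂ p unitDisk
  map_zero : p 0 = 1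
  re_pos : ∀ z ∈ unitDisk, 0 < (p z).re

/-- The **Noshiro–Warschawski theorem**. -/
theorem injOn_of_re_deriv_pos {F F' : ℂ → ℂ} {U : Set ℂ} (hU : Convex ℝ U)
    (hF : ∀ z ∈ U, HasDerivAt F (F' z) z) (hpos : ∀ z ∈ U, 0 < (F' z).re) : InjOn F U := by
  intro a ha b hb hab
  by_contra hne
  have hba : b - a ≠ 0 := sub_ne_zero.2 (Ne.symm hne)
  have hmem : ∀ t ∈ Icc (0 : ℝ) 1, a + t * (b - a) ∈ U := fun t ht => by
    simpa using hU.add_smul_sub_mem ha hb ht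
  have hderiv : ∀ t ∈ Icc (0 : ℝ) 1, HasDerivAt (fun t : ℝ => (F (a + t * (b - a)) / (b - a)).re)
      (F' (a + t * (b - a))).re t := by
    intro t ht
    have hsegment : HasDerivAt (fun s : ℂ => a + s * (b - a)) (b - a) (t : ℂ) := by
      simpa using ((hasDerivAt_id (t : ℂ)).mul_const (b - a)).const_add a
    have hquotient := ((hF _ (hmem t ht)).comp (t : ℂ) hsegment).div_const (b - a)
    rw [mul_div_cancel_right₀ _ hba] at hquotient
    exact hquotient.real_of_complex
  have hmono : StrictMonoOn (fun t : ℝ => (F (a + t * (b - a)) / (b - a)).re) (Icc 0 1) := by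
    refine strictMonoOn_of_deriv_pos (convex_Icc 0 1)
      (fun t ht => (hderiv t ht).continuousAt.continuousWithinAt) fun t ht => ?_
    rw [(hderiv t (interior_subset ht)).deriv]
    exact hpos _ (hmem t (interior_subset ht))
  have hlt := hmono (left_mem_Icc.2 zero_le_one) (right_mem_Icc.2 zero_le_one) zero_lt_one
  simp [hab] at hlt

lemma exp_mem_unitDisk {ζ : ℂ} (hζ : ζ.re < 0) : exp ζ ∈ unitDisk := by
  rwa [mem_unitDisk, norm_exp, Real.exp_lt_one_iff]

lemma log_re_neg {z : ℂ} (hz : z ∈ unitDisk) (hz0 : z ≠ 0) : (log z).re < 0 := by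
  rw [log_re]
  exact Real.log_neg (norm_pos_iff.2 hz0) (mem_unitDisk.1 hz)

lemma injOn_add_comp_exp {h h' : ℂ → ℂ} (hh : ∀ z ∈ unitDisk, HasDerivAt h (h' z) z)
    (hre : ∀ z ∈ unitDisk, 0 < (1 + z * h' z).re) :
    InjOn (fun ζ => ζ + h (exp ζ)) {ζ : ℂ | ζ.re < 0} :=
  injOn_of_re_deriv_pos (F' := fun ζ => 1 + exp ζ * h' (exp ζ)) (convex_halfSpace_re_lt 0)
    (fun ζ hζ => ((hasDerivAt_id ζ).add
      ((hh _ (exp_mem_unitDisk hζ)).comp ζ (hasDerivAt_exp ζ))).congr_deriv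
        (by rw [mul_comm]))
    fun ζ hζ => hre _ (exp_mem_unitDisk hζ)

/-- In the coordinate `ζ = log z` the map `z ↦ z * exp (h z)` is conjugate to `ζ ↦ ζ + h (exp ζ)`;
two preimages of one point have logarithms differing by a period of `exp`. -/
lemma injOn_mul_exp {h h' : ℂ → ℂ} (hh : ∀ z ∈ unitDisk, HasDerivAt h (h' z) z)
    (hre : ∀ z ∈ unitDisk, 0 < (1 + z * h' z).re) :
    InjOn (fun z => z * exp (h z)) unitDisk := by
  intro a ha b hb hab
  have hab' : a * exp (h a) = b * exp (h b) := hab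
  rcases eq_or_ne a 0 with rfl | ha0
  · simpa [exp_ne_zero, eq_comm] using hab'
  rcases eq_or_ne b 0 with rfl | hb0
  · simpa [exp_ne_zero] using hab'
  have hexp : exp (log a + h a) = exp (log b + h b) := by
    rwa [exp_add, exp_add, exp_log ha0, exp_log hb0]
  obtain ⟨n, hn⟩ := exp_eq_exp_iff_exists_int.1 hexp
  have hperiod : exp (log b + n * (2 * Real.pi * I)) = b := by
    rw [exp_periodic.int_mul n, exp_log hb0]
  have hlog : log a = log b + n * (2 * Real.pi * I) := by
    refine injOn_add_comp_exp hh hre (log_re_neg ha ha0) ?_ ?_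
    · simpa using log_re_neg hb hb0
    · simp only [hperiod, exp_log ha0]
      linear_combination hn
  rw [← exp_log ha0, hlog, hperiod]

theorem IsCaratheodory.exists_starQuotient_eqOn {p : ℂ → ℂ} (hp : IsCaratheodory p) :
    ∃ f, IsNormalizedUnivalent f ∧ EqOn (starQuotient f) p unitDisk := by
  have hslope : DifferentiableOn ℂ (dslope p 0) unitDisk :=
    (differentiableOn_dslope (Metric.ball_mem_nhds 0 one_pos)).2 hp.differentiableOn
  obtain ⟨h, h_zero, hh⟩ := (DifferentiableOn.isExactOn_ball hslope).with_val_at 0 0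
  have hmul (z : ℂ) : 1 + z * dslope p 0 z = p z := by
    have := sub_smul_dslope p 0 z
    rw [sub_zero, smul_eq_mul, hp.map_zero] at this
    rw [this, add_sub_cancel]
  have hderiv : ∀ z ∈ unitDisk, HasDerivAt (fun z => z * exp (h z)) (exp (h z) * p z) z := by
    intro z hz
    refine ((hasDerivAt_id z).mul (hh z hz).cexp).congr_deriv ?_
    rw [← hmul, id]
    ring
  refine ⟨fun z => z * exp (h z),
    ⟨fun z hz => (hderiv z hz).differentiableAt.differentiableWithinAt, zero_mul _, ?_,
      injOn_mul_exp hh fun z hz => ?_⟩, fun z hz => ?_⟩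
  · rw [(hderiv 0 zero_mem_unitDisk).deriv, h_zero, hp.map_zero, exp_zero, one_mul]
  · rw [hmul]
    exact hp.re_pos z hz
  · rcases eq_or_ne z 0 with rfl | hz0
    · rw [starQuotient, if_pos rfl, hp.map_zero]
    · rw [starQuotient, if_neg hz0, (hderiv z hz).deriv]
      field_simp

/-! ### Subordination and dilations -/

/-- The Lindelöf principle. -/
lemma Subordinate.mapsTo_ball {p φ : ℂ → ℂ} (h : Subordinate p φ) {r : ℝ} (hr : r ≤ 1) :
    MapsTo p (Metric.ball 0 r) (φ '' Metric.ball 0 r) := by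
  obtain ⟨ω, hω, hmaps, hω0, hp⟩ := h
  intro z hz
  rw [mem_ball_zero_iff] at hz
  have hz1 : ‖z‖ < 1 := hz.trans_le hr
  refine ⟨ω z, mem_ball_zero_iff.2 (lt_of_le_of_lt ?_ hz), (hp z (mem_unitDisk.2 hz1)).symm⟩
  exact norm_le_norm_of_mapsTo_ball hω (hmaps.mono_right Metric.ball_subset_closedBall) hω0 hz1

lemma Subordinate.differentiableOn {p φ : ℂ → ℂ} (h : Subordinate p φ)
    (hφ : DifferentiableOn ℂ φ unitDisk) : DifferentiableOn ℂ p unitDisk := by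
  obtain ⟨ω, hω, hmaps, -, hp⟩ := h
  exact (hφ.comp hω hmaps).congr hp

lemma subordinate_of_mapsTo {p φ g : ℂ → ℂ} (hg : DifferentiableOn ℂ g (φ '' unitDisk))
    (hgφ : LeftInvOn g φ unitDisk) (hp : DifferentiableOn ℂ p unitDisk)
    (hmaps : MapsTo p unitDisk (φ '' unitDisk)) (h0 : p 0 = φ 0) : Subordinate p φ := by
  refine ⟨g ∘ p, hg.comp hp hmaps, fun z hz => ?_, ?_, fun z hz => ?_⟩
  · obtain ⟨ζ, hζ, h⟩ := hmaps hz
    rwa [Function.comp_apply, ← h, hgφ hζ]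
  · rw [Function.comp_apply, h0, hgφ zero_mem_unitDisk]
  · obtain ⟨ζ, hζ, h⟩ := hmaps hz
    rw [Function.comp_apply, ← h, hgφ hζ]

lemma mapsTo_mul_unitDisk {r : ℝ} (hr : 0 < r) :
    MapsTo (fun z : ℂ => r * z) unitDisk (Metric.ball 0 r) := by
  intro z hz
  rw [mem_ball_zero_iff, norm_mul, norm_real, Real.norm_of_nonneg hr.le]
  exact mul_lt_of_lt_one_right hr (mem_unitDisk.1 hz)

lemma ball_subset_unitDisk {r : ℝ} (hr : r ≤ 1) : Metric.ball (0 : ℂ) r ⊆ unitDisk :=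
  Metric.ball_subset_ball hr

lemma deriv_dilate (f : ℂ → ℂ) {r : ℝ} (hr : r ≠ 0) (z : ℂ) :
    deriv (dilate f r) z = deriv f (r * z) := by
  unfold dilate
  rw [deriv_div_const, deriv_comp_mul_left, smul_eq_mul,
    mul_div_cancel_left₀ _ (ofReal_ne_zero.2 hr)]

lemma starQuotient_dilate (f : ℂ → ℂ) {r : ℝ} (hr : r ≠ 0) (z : ℂ) :
    starQuotient (dilate f r) z = starQuotient f (r * z) := by
  rcases eq_or_ne z 0 with rfl | hz
  · simp [starQuotient]
  · have hrz : (r : ℂ) * z ≠ 0 := mul_ne_zero (ofReal_ne_zero.2 hr) hz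
    rw [starQuotient, if_neg hz, starQuotient, if_neg hrz, deriv_dilate f hr, dilate,
      div_div_eq_mul_div]
    ring

lemma IsNormalizedUnivalent.dilate {f : ℂ → ℂ} (hf : IsNormalizedUnivalent f) {r : ℝ}
    (hr : 0 < r) (hr1 : r ≤ 1) : IsNormalizedUnivalent (dilate f r) := by
  have hr0 : (r : ℂ) ≠ 0 := ofReal_ne_zero.2 hr.ne'
  have hmaps : MapsTo (fun z : ℂ => r * z) unitDisk unitDisk :=
    (mapsTo_mul_unitDisk hr).mono_right (ball_subset_unitDisk hr1)
  exact
    { differentiableOn := (hf.differentiableOn.comp (by fun_prop) hmaps).div_const _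
      map_zero := by rw [CarRadius.dilate, mul_zero, hf.map_zero, zero_div]
      deriv_zero := by rw [deriv_dilate f hr.ne', mul_zero, hf.deriv_zero]
      injOn := fun a ha b hb hab =>
        mul_left_cancel₀ hr0 (hf.injOn (hmaps ha) (hmaps hb) ((div_left_inj' hr0).1 hab)) }

/-! ### The radius of one Ma–Minda class in another -/

section Radius

variable {φ ψ g : ℂ → ℂ} {R : ℝ}

lemma dilate_mem_starClass (hg : DifferentiableOn ℂ g (φ '' unitDisk))
    (hgφ : LeftInvOn g φ unitDisk) (hφ0 : φ 0 = 1) (hψ : DifferentiableOn ℂ ψ unitDisk)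
    (hR : 0 < R) (hR1 : R ≤ 1) (hmaps : MapsTo ψ (Metric.ball 0 R) (φ '' unitDisk))
    {f : ℂ → ℂ} (hf : f ∈ starClass ψ) : dilate f R ∈ starClass φ := by
  obtain ⟨hfS, hsub⟩ := hf
  have hscale := mapsTo_mul_unitDisk hR
  have hquot : starQuotient (dilate f R) = fun z => starQuotient f (R * z) :=
    funext (starQuotient_dilate f hR.ne')
  refine ⟨hfS.dilate hR hR1, subordinate_of_mapsTo hg hgφ ?_ ?_ ?_⟩
  · rw [hquot]
    exact (hsub.differentiableOn hψ).comp (by fun_prop)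
      (hscale.mono_right (ball_subset_unitDisk hR1))
  · rw [hquot]
    intro z hz
    obtain ⟨ζ, hζ, h⟩ := hsub.mapsTo_ball hR1 (hscale hz)
    simpa only [← h] using hmaps hζ
  · rw [starQuotient, if_pos rfl, hφ0]

theorem isSharpRadius_starClass (hg : DifferentiableOn ℂ g (φ '' unitDisk))
    (hgφ : LeftInvOn g φ unitDisk) (hφ0 : φ 0 = 1) (hψ : IsCaratheodory ψ) (hR : 0 < R)
    (hR1 : R ≤ 1) (hmaps : MapsTo ψ (Metric.ball 0 R) (φ '' unitDisk)) {z₀ : ℂ}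
    (hz₀ : ‖z₀‖ = R) (hψz₀ : ψ z₀ ∉ φ '' unitDisk) :
    IsSharpRadius (starClass φ) (starClass ψ) R := by
  obtain ⟨f, hfS, hf⟩ := hψ.exists_starQuotient_eqOn
  have hfψ : f ∈ starClass ψ := ⟨hfS, id, differentiableOn_id, mapsTo_id _, rfl, hf⟩
  have hextremal : ∀ r : ℝ, R < r → r ≤ 1 → dilate f r ∉ starClass φ := by
    rintro r hRr hr1 ⟨-, ω, -, hω, -, hsub⟩
    have hr : 0 < r := hR.trans hRr
    have hz : z₀ / r ∈ unitDisk := by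
      rwa [mem_unitDisk, norm_div, norm_real, Real.norm_of_nonneg hr.le, hz₀, div_lt_one hr]
    have hrz : r * (z₀ / r) = z₀ := mul_div_cancel₀ _ (ofReal_ne_zero.2 hr.ne')
    refine hψz₀ ⟨ω (z₀ / r), hω hz, ?_⟩
    rw [← hsub _ hz, starQuotient_dilate f hr.ne', hrz,
      hf (mem_unitDisk.2 (hz₀.trans_lt (hRr.trans_le hr1)))]
  refine ⟨⟨⟨hR, hR1, fun f' hf' r hr hrR => ?_⟩, fun r ⟨hr, hr1, hall⟩ => ?_⟩, f, hfψ, hextremal⟩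
  · exact dilate_mem_starClass hg hgφ hφ0 hψ.differentiableOn hr (hrR.trans hR1)
      (hmaps.mono_left (Metric.ball_subset_ball hrR)) hf'
  · exact not_lt.1 fun hRr => hextremal r hRr hr1 (hall f hfψ r hr le_rfl)

end Radius

/-! ### The principal square root -/

lemma csqrt_sq (z : ℂ) : csqrt z ^ 2 = z := by
  rw [csqrt, one_div]
  exact cpow_nat_inv_pow z two_ne_zero

lemma csqrt_sq_of_re_pos {z : ℂ} (hz : 0 < z.re) : csqrt (z ^ 2) = z := by
  rw [csqrt, one_div, sq_cpow_two_inv hz]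

lemma csqrt_one : csqrt 1 = 1 := one_cpow _

lemma csqrt_ofReal_sq {t : ℝ} (ht : 0 < t) : csqrt ((t : ℂ) ^ 2) = t :=
  csqrt_sq_of_re_pos (by rwa [ofReal_re])

lemma norm_csqrt_sq (z : ℂ) : ‖csqrt z‖ ^ 2 = ‖z‖ := by rw [← norm_pow, csqrt_sq]

lemma re_csqrt (z : ℂ) : (csqrt z).re = √((‖z‖ + z.re) / 2) := by
  rw [csqrt, one_div, cpow_inv_two_re]

lemma re_csqrt_nonneg (z : ℂ) : 0 ≤ (csqrt z).re := by
  rw [re_csqrt]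
  exact Real.sqrt_nonneg _

lemma re_csqrt_pos {z : ℂ} (hz : z ∈ slitPlane) : 0 < (csqrt z).re := by
  rw [re_csqrt]
  refine Real.sqrt_pos.2 (half_pos ?_)
  have hle := abs_le.1 (abs_re_le_norm z)
  rcases mem_slitPlane_iff.1 hz with hre | him
  · linarith
  · have hlt := abs_lt.1 (abs_re_lt_norm.2 him)
    linarith

lemma lt_re_csqrt {t : ℝ} {z : ℂ} (h : t ^ 2 < z.re) : t < (csqrt z).re := by
  rw [re_csqrt]
  exact Real.lt_sqrt_of_sq_lt (by linarith [re_le_norm z])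

lemma differentiableAt_csqrt {z : ℂ} (hz : z ∈ slitPlane) : DifferentiableAt ℂ csqrt z :=
  differentiableAt_id.cpow_const hz

lemma sq_mem_slitPlane {z : ℂ} (hz : 0 < z.re) : z ^ 2 ∈ slitPlane := by
  rw [mem_slitPlane_iff, sq, mul_re, mul_im]
  rcases eq_or_ne z.im 0 with him | him
  · left
    rw [him]
    nlinarith
  · right
    have := mul_ne_zero hz.ne' him
    ring_nf
    simpa using this

lemma norm_csqrt_one_add_sub_one_le (z : ℂ) : ‖csqrt (1 + z) - 1‖ ≤ ‖z‖ := by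
  have hfactor : (csqrt (1 + z) - 1) * (csqrt (1 + z) + 1) = z := by
    linear_combination csqrt_sq (1 + z)
  have hone : 1 ≤ ‖csqrt (1 + z) + 1‖ := by
    refine le_trans ?_ (re_le_norm _)
    rw [add_re, one_re]
    linarith [re_csqrt_nonneg (1 + z)]
  calc ‖csqrt (1 + z) - 1‖ ≤ ‖csqrt (1 + z) - 1‖ * ‖csqrt (1 + z) + 1‖ :=
        le_mul_of_one_le_right (norm_nonneg _) hone
    _ = ‖z‖ := by rw [← norm_mul, hfactor]

/-! ### The cardioid domain -/

lemma two_mul_phiCar_sub_one (z : ℂ) : 2 * phiCar z - 1 = (1 + z) ^ 2 := by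
  unfold phiCar
  ring

lemma re_one_add_pos {z : ℂ} (hz : z ∈ unitDisk) : 0 < (1 + z).re := by
  have := (abs_le.1 (abs_re_le_norm z)).1
  rw [add_re, one_re]
  linarith [mem_unitDisk.1 hz]

lemma leftInvOn_phiCar : LeftInvOn (fun w => csqrt (2 * w - 1) - 1) phiCar unitDisk := by
  intro z hz
  simp only [two_mul_phiCar_sub_one, csqrt_sq_of_re_pos (re_one_add_pos hz), add_sub_cancel_left]

lemma differentiableOn_phiCar_leftInv :
    DifferentiableOn ℂ (fun w => csqrt (2 * w - 1) - 1) (phiCar '' unitDisk) := by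
  rintro _ ⟨z, hz, rfl⟩
  have hslit : 2 * phiCar z - 1 ∈ slitPlane := by
    rw [two_mul_phiCar_sub_one]
    exact sq_mem_slitPlane (re_one_add_pos hz)
  have hlin : DifferentiableAt ℂ (fun w : ℂ => 2 * w - 1) (phiCar z) := by fun_prop
  have hroot := (differentiableAt_csqrt hslit).comp (phiCar z) hlin
  exact (hroot.sub_const 1).differentiableWithinAt

lemma half_notMem_image_phiCar : (1 / 2 : ℂ) ∉ phiCar '' unitDisk := by
  rintro ⟨z, hz, h⟩
  have hsq := two_mul_phiCar_sub_one z
  rw [h, mul_one_div_cancel two_ne_zero, sub_self, eq_comm, sq_eq_zero_iff] at hsq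
  simpa [hsq] using re_one_add_pos hz

/-- With `s = √(2 w - 1)` the hypothesis reads `‖s‖ ^ 4 < 4 (Re s) ^ 2`, which says that `s` lies
in one of the unit disks centred at `±1`; the principal root lies in the one on the right. -/
lemma mem_image_phiCar_of_norm_sq_lt {w : ℂ}
    (h : ‖2 * w - 1‖ ^ 2 < 2 * (‖2 * w - 1‖ + (2 * w - 1).re)) : w ∈ phiCar '' unitDisk := by
  set s := csqrt (2 * w - 1)
  have hs : s ^ 2 = 2 * w - 1 := csqrt_sq _
  have hnorm : ‖s‖ ^ 2 = s.re ^ 2 + s.im ^ 2 := sq_norm_eq s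
  have hre : (2 * w - 1).re = s.re ^ 2 - s.im ^ 2 := by rw [← hs, sq, mul_re]; ring
  have hlt : ‖s‖ ^ 2 < 2 * s.re := by
    refine lt_of_pow_lt_pow_left₀ 2 (by linarith [re_csqrt_nonneg (2 * w - 1)]) ?_
    rw [← norm_csqrt_sq, hre] at h
    linarith
  refine ⟨s - 1, mem_unitDisk.2 ?_, ?_⟩
  · rw [← sq_lt_one_iff₀ (norm_nonneg _), sq_norm_eq, sub_re, sub_im, one_re, one_im]
    linarith
  · unfold phiCar
    linear_combination hs / 2

/-- The circle `‖w - 1‖ ^ 2 = 5 / 4` meets the line `Re w = 1 / 2` in the points `1 / 2 ± I`, which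
lie on the boundary of the cardioid domain. -/
lemma mem_image_phiCar_of_half_lt_re {w : ℂ} (hre : 1 / 2 < w.re) (hnorm : ‖w - 1‖ ^ 2 ≤ 5 / 4) :
    w ∈ phiCar '' unitDisk := by
  apply mem_image_phiCar_of_norm_sq_lt
  have hζ : ‖2 * w - 1‖ ^ 2 = 4 * ‖w - 1‖ ^ 2 - 1 + 2 * (2 * w - 1).re := by
    simp only [sq_norm_eq, sub_re, sub_im, mul_re, mul_im, one_re, one_im, re_ofNat,
      im_ofNat]
    ring
  have hpos : 0 < (2 * w - 1).re := by
    simp only [sub_re, mul_re, one_re, re_ofNat, im_ofNat]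
    linarith
  rcases lt_or_ge ‖2 * w - 1‖ 2 with hlt | hge
  · nlinarith [norm_nonneg (2 * w - 1)]
  · nlinarith

lemma mem_image_phiCar_of_norm_sub_lt {w : ℂ} (h : ‖w - 3 / 2‖ < 1) : w ∈ phiCar '' unitDisk := by
  apply mem_image_phiCar_of_norm_sq_lt
  have hζ : ‖2 * w - 1‖ ^ 2 = 4 * (‖w - 3 / 2‖ ^ 2 - 1) + 4 * (2 * w - 1).re := by
    simp only [sq_norm_eq, sub_re, sub_im, mul_re, mul_im, one_re, one_im, re_ofNat,
      im_ofNat, div_ofNat_re, div_ofNat_im]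
    ring
  have hsq : ‖w - 3 / 2‖ ^ 2 < 1 := (sq_lt_one_iff₀ (norm_nonneg _)).2 h
  linarith [re_le_norm (2 * w - 1)]

section CardioidRadius

variable {ψ : ℂ → ℂ} {R : ℝ}

theorem isSharpRadius_starCar (hψ : IsCaratheodory ψ) (hR : 0 < R) (hR1 : R ≤ 1)
    (hmem : ∀ z : ℂ, ‖z‖ < R → ψ z ∈ phiCar '' unitDisk) (hcusp : ψ (-R) = 1 / 2) :
    IsSharpRadius starCar (starClass ψ) R := by
  refine isSharpRadius_starClass differentiableOn_phiCar_leftInv leftInvOn_phiCar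
    (by simp [phiCar]) hψ hR hR1 (fun z hz => hmem z (mem_ball_zero_iff.1 hz)) (z₀ := -R) ?_ ?_
  · rw [norm_neg, norm_real, Real.norm_of_nonneg hR.le]
  · rw [hcusp]
    exact half_notMem_image_phiCar

theorem isSharpRadius_starCar_of_half_lt_re (hψ : IsCaratheodory ψ) (hR : 0 < R) (hR1 : R ≤ 1)
    (hre : ∀ z : ℂ, ‖z‖ < R → 1 / 2 < (ψ z).re) (hnorm : ∀ z : ℂ, ‖z‖ < R → ‖ψ z - 1‖ ≤ 1)
    (hcusp : ψ (-R) = 1 / 2) : IsSharpRadius starCar (starClass ψ) R :=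
  isSharpRadius_starCar hψ hR hR1 (fun z hz => mem_image_phiCar_of_half_lt_re (hre z hz)
    (by linarith [(sq_le_one_iff₀ (norm_nonneg (ψ z - 1))).2 (hnorm z hz)])) hcusp

end CardioidRadius

/-! ### Classes built from the square root -/

section AffineSqrt

variable {α c t R : ℝ}

lemma norm_ofReal_mul_lt_one (hc0 : 0 ≤ c) (hc1 : c ≤ 1) {z : ℂ} (hz : z ∈ unitDisk) :
    ‖(c : ℂ) * z‖ < 1 := by
  rw [norm_mul, norm_real, Real.norm_of_nonneg hc0]
  exact mul_lt_one_of_nonneg_of_lt_one_right hc1 (norm_nonneg z) (mem_unitDisk.1 hz)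

lemma re_affine_sqrt (w : ℂ) :
    ((α : ℂ) + (1 - α) * csqrt w).re = α + (1 - α) * (csqrt w).re := by
  rw [add_re, ofReal_re, ← ofReal_one, ← ofReal_sub, re_ofReal_mul]

lemma isCaratheodory_affine_sqrt (hα0 : 0 ≤ α) (hα1 : α < 1) (hc0 : 0 ≤ c) (hc1 : c ≤ 1) :
    IsCaratheodory fun z => α + (1 - α) * csqrt (1 + c * z) where
  differentiableOn := fun z hz => by
    have hslit := mem_slitPlane_of_norm_lt_one (norm_ofReal_mul_lt_one hc0 hc1 hz)
    have hlin : DifferentiableAt ℂ (fun z : ℂ => 1 + c * z) z := by fun_prop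
    have hroot := (differentiableAt_csqrt hslit).comp z hlin
    exact ((hroot.const_mul (1 - α : ℂ)).const_add (α : ℂ)).differentiableWithinAt
  map_zero := by
    rw [mul_zero, add_zero, csqrt_one]
    ring
  re_pos := fun z hz => by
    have hroot := re_csqrt_pos (mem_slitPlane_of_norm_lt_one (norm_ofReal_mul_lt_one hc0 hc1 hz))
    rw [re_affine_sqrt]
    exact add_pos_of_nonneg_of_pos hα0 (mul_pos (sub_pos.2 hα1) hroot)

/-- The parameter `t = √(1 - c R)` is the value of the root at the extremal point `-R`. -/
theorem isSharpRadius_affine_sqrt (hα0 : 0 ≤ α) (hα : α < 1 / 2) (hc0 : 0 < c) (hc1 : c ≤ 1)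
    (ht : 2 * (1 - α) * t = 1 - 2 * α) (hR : c * R = 1 - t ^ 2) (hR1 : R ≤ 1) :
    IsSharpRadius starCar (starClass fun z => α + (1 - α) * csqrt (1 + c * z)) R := by
  have ht0 : 0 < t := by nlinarith
  have ht1 : t < 1 := by nlinarith
  have hR0 : 0 < R := by nlinarith
  refine isSharpRadius_starCar_of_half_lt_re
    (isCaratheodory_affine_sqrt hα0 (by linarith) hc0.le hc1) hR0 hR1
    (fun z hz => ?_) (fun z hz => ?_) ?_
  · have hroot : t < (csqrt (1 + c * z)).re := by
      refine lt_re_csqrt ?_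
      rw [add_re, one_re, re_ofReal_mul]
      nlinarith [(abs_le.1 (abs_re_le_norm z)).1]
    rw [re_affine_sqrt]
    nlinarith
  · have hfactor : α + (1 - α) * csqrt (1 + c * z) - 1 =
        ((1 - α : ℝ) : ℂ) * (csqrt (1 + c * z) - 1) := by
      push_cast
      ring
    rw [hfactor, norm_mul, norm_real, Real.norm_of_nonneg (by linarith)]
    refine mul_le_one₀ (by linarith) (norm_nonneg _)
      ((norm_csqrt_one_add_sub_one_le _).trans ?_)
    exact (norm_ofReal_mul_lt_one hc0.le hc1 (mem_unitDisk.2 (hz.trans_le hR1))).le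
  · have hval : (1 + c * -R : ℂ) = (t : ℂ) ^ 2 := by
      have : 1 + c * -R = t ^ 2 := by linarith
      exact_mod_cast this
    have htℂ : (2 * (1 - α) * t : ℂ) = 1 - 2 * α := by exact_mod_cast ht
    rw [hval, csqrt_ofReal_sq ht0]
    linear_combination htℂ / 2

theorem isSharpRadius_psiCassini (hc : 3 / 4 < c) (hc1 : c ≤ 1) :
    IsSharpRadius starCar (starClass (psiCassini c)) (3 / (4 * c)) := by
  have hc0 : 0 < c := by linarith
  have hψ : psiCassini c = fun z => ((0 : ℝ) : ℂ) + (1 - (0 : ℝ)) * csqrt (1 + c * z) := by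
    funext z
    simp [psiCassini]
  rw [hψ]
  refine isSharpRadius_affine_sqrt (t := 1 / 2) le_rfl (by norm_num) hc0 hc1 (by norm_num) ?_ ?_
  · field_simp
    norm_num
  · rw [div_le_one (by linarith)]
    linarith

theorem isSharpRadius_psiL (hα0 : 0 ≤ α) (hα : α < 1 / 2) :
    IsSharpRadius starCar (starClass (psiL α)) ((3 - 4 * α) / (4 * (1 - α) ^ 2)) := by
  have hα1 : 1 - α ≠ 0 := by linarith
  have hψ : psiL α = fun z => (α : ℂ) + (1 - α) * csqrt (1 + (1 : ℝ) * z) := by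
    funext z
    simp [psiL]
  rw [hψ]
  refine isSharpRadius_affine_sqrt (t := (1 - 2 * α) / (2 * (1 - α))) hα0 hα one_pos le_rfl
    (by field_simp) ?_ ?_
  · field_simp
    ring
  · rw [div_le_one (by positivity)]
    nlinarith [sq_nonneg (1 - 2 * α)]

end AffineSqrt

section Moebius

variable {a R : ℝ} {z : ℂ}

lemma re_moebius_pos (ha0 : 0 ≤ a) (ha1 : a ≤ 1) (hz : ‖z‖ < 1) :
    0 < ((1 - z) / (1 + a * z)).re := by
  have hsq := re_sq_add_im_sq_lt hz
  have hx := abs_lt.1 ((abs_re_le_norm z).trans_lt hz)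
  have hden : 1 + a * z ≠ 0 := by
    intro h
    have := congrArg re h
    rw [add_re, one_re, re_ofReal_mul, zero_re] at this
    nlinarith
  have hnum : ((1 - z) / (1 + a * z)).re * normSq (1 + a * z) =
      1 - (1 - a) * z.re - a * (z.re ^ 2 + z.im ^ 2) := by
    have hN := normSq_pos.2 hden
    rw [div_re, ← add_div, div_mul_cancel₀ _ hN.ne']
    simp only [sub_re, one_re, add_re, sub_im, one_im, add_im, re_ofReal_mul, im_ofReal_mul]
    ring
  refine pos_of_mul_pos_left ?_ (normSq_nonneg (1 + a * z))
  rw [hnum]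
  nlinarith [mul_nonneg (sub_nonneg.2 ha1) (sq_nonneg (z.re - 1)),
    mul_nonneg (sub_nonneg.2 ha1) (sq_nonneg z.im)]

lemma norm_csqrt_moebius_lt {s : ℝ} (ha : 0 ≤ a) (hs : 0 ≤ s) (hz : ‖z‖ < R)
    (hsR : 1 + R = s ^ 2 * (1 - a * R)) : ‖csqrt ((1 - z) / (1 + a * z))‖ < s := by
  have hR0 : 0 < R := (norm_nonneg z).trans_lt hz
  have haR : 0 < 1 - a * R := pos_of_mul_pos_right (hsR ▸ by linarith) (sq_nonneg s)
  have hden : 1 - a * R ≤ ‖1 + a * z‖ := by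
    have htri := norm_sub_le (1 + a * z) (a * z)
    rw [add_sub_cancel_right, norm_one, norm_mul, norm_real, Real.norm_of_nonneg ha] at htri
    nlinarith
  have hnum : ‖1 - z‖ < 1 + R := (norm_sub_le 1 z).trans_lt (by rw [norm_one]; linarith)
  refine lt_of_pow_lt_pow_left₀ 2 hs ?_
  rw [norm_csqrt_sq, norm_div, div_lt_iff₀ (haR.trans_le hden)]
  calc ‖1 - z‖ < s ^ 2 * (1 - a * R) := hsR ▸ hnum
    _ ≤ s ^ 2 * ‖1 + a * z‖ := mul_le_mul_of_nonneg_left hden (sq_nonneg s)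

end Moebius

lemma sq_sqrt_two : √2 ^ 2 = 2 := Real.sq_sqrt zero_le_two

lemma sqrt_two_mem_Ioo : √2 ∈ Ioo 1.41 1.42 :=
  ⟨Real.lt_sqrt_of_sq_lt (by norm_num), (Real.sqrt_lt' (by norm_num)).2 (by norm_num)⟩

lemma psiRL_eq (z : ℂ) : psiRL z =
    (√2 : ℝ) - ((√2 - 1 : ℝ) : ℂ) * csqrt ((1 - z) / (1 + (2 * (√2 - 1) : ℝ) * z)) := by
  unfold psiRL
  push_cast
  rfl

lemma isCaratheodory_psiRL : IsCaratheodory psiRL := by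
  obtain ⟨hlo, hhi⟩ := sqrt_two_mem_Ioo
  have hpos : ∀ z ∈ unitDisk, 0 < ((1 - z) / (1 + (2 * (√2 - 1) : ℝ) * z)).re := fun z hz =>
    re_moebius_pos (by linarith) (by linarith) (mem_unitDisk.1 hz)
  refine ⟨fun z hz => ?_, by rw [psiRL_eq]; simp [csqrt_one], fun z hz => ?_⟩
  · have hden : 1 + (2 * (√2 - 1) : ℝ) * z ≠ 0 := fun h => by
      have hlt := hpos z hz
      rw [h, div_zero, zero_re] at hlt
      exact hlt.false
    have hmoebius : DifferentiableAt ℂ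
        (fun z : ℂ => (1 - z) / (1 + (2 * (√2 - 1) : ℝ) * z)) z :=
      DifferentiableAt.div (by fun_prop) (by fun_prop) hden
    have hroot := (differentiableAt_csqrt (mem_slitPlane_iff.2 (.inl (hpos z hz)))).comp z hmoebius
    rw [funext psiRL_eq]
    exact ((hroot.const_mul _).const_sub _).differentiableWithinAt
  · have hroot := (re_le_norm _).trans_lt (norm_csqrt_moebius_lt (s := 2 + √2) (by linarith)
      (by linarith) (mem_unitDisk.1 hz) (a := 2 * (√2 - 1)) (by
        linear_combination (2 * √2 + 5) * sq_sqrt_two))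
    rw [psiRL_eq, sub_re, ofReal_re, re_ofReal_mul]
    nlinarith [sq_sqrt_two]

lemma one_add_radius_psiRL : 1 + (39 + 17 * √2) / 82 =
    ((3 + √2) / 2) ^ 2 * (1 - 2 * (√2 - 1) * ((39 + 17 * √2) / 82)) := by
  linear_combination (17 * √2 ^ 2 + 124 * √2 + 239) / 164 * sq_sqrt_two

lemma norm_psiRL_sub_lt {z : ℂ} (hz : ‖z‖ < (39 + 17 * √2) / 82) : ‖psiRL z - 3 / 2‖ < 1 := by
  obtain ⟨hlo, hhi⟩ := sqrt_two_mem_Ioo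
  have hroot := norm_csqrt_moebius_lt (by linarith) (by linarith) hz one_add_radius_psiRL
  calc ‖psiRL z - 3 / 2‖
      = ‖((3 / 2 - √2 : ℝ) : ℂ) +
          ((√2 - 1 : ℝ) : ℂ) * csqrt ((1 - z) / (1 + (2 * (√2 - 1) : ℝ) * z))‖ := by
        rw [psiRL_eq, ← norm_neg]
        push_cast
        ring_nf
    _ ≤ (3 / 2 - √2) + (√2 - 1) * ‖csqrt ((1 - z) / (1 + (2 * (√2 - 1) : ℝ) * z))‖ := by
        refine (norm_add_le _ _).trans_eq ?_
        rw [norm_mul, norm_real, norm_real, Real.norm_of_nonneg (by linarith),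
          Real.norm_of_nonneg (by linarith)]
    _ < (3 / 2 - √2) + (√2 - 1) * ((3 + √2) / 2) := by gcongr; linarith
    _ = 1 := by linear_combination sq_sqrt_two / 2

lemma psiRL_neg_radius : psiRL (-((39 + 17 * √2) / 82 : ℝ)) = 1 / 2 := by
  obtain ⟨hlo, hhi⟩ := sqrt_two_mem_Ioo
  have hval : (1 - -(((39 + 17 * √2) / 82 : ℝ) : ℂ)) /
      (1 + (2 * (√2 - 1) : ℝ) * -(((39 + 17 * √2) / 82 : ℝ) : ℂ)) =
      (((3 + √2) / 2 : ℝ) : ℂ) ^ 2 := by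
    norm_cast
    rw [div_eq_iff (by nlinarith)]
    linear_combination one_add_radius_psiRL
  have hsqrt : ((√2 : ℝ) : ℂ) ^ 2 = 2 := by exact_mod_cast sq_sqrt_two
  rw [psiRL_eq, hval, csqrt_ofReal_sq (by positivity)]
  push_cast
  linear_combination -hsqrt / 2

theorem isSharpRadius_psiRL :
    IsSharpRadius starCar (starClass psiRL) ((39 + 17 * √2) / 82) :=
  isSharpRadius_starCar isCaratheodory_psiRL (by positivity) (by linarith [sqrt_two_mem_Ioo.2])
    (fun _ hz => mem_image_phiCar_of_norm_sub_lt (norm_psiRL_sub_lt hz)) psiRL_neg_radius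

lemma psiCrescent_sq_sub_one (z : ℂ) : psiCrescent z ^ 2 - 1 = 2 * z * psiCrescent z := by
  unfold psiCrescent
  linear_combination csqrt_sq (1 + z ^ 2)

lemma one_add_sq_mem_slitPlane {z : ℂ} (hz : z ∈ unitDisk) : 1 + z ^ 2 ∈ slitPlane := by
  refine mem_slitPlane_of_norm_lt_one ?_
  rw [norm_pow]
  exact pow_lt_one₀ (norm_nonneg _) (mem_unitDisk.1 hz) two_ne_zero

lemma isCaratheodory_psiCrescent : IsCaratheodory psiCrescent where
  differentiableOn := fun z hz => by
    have hsq : DifferentiableAt ℂ (fun z : ℂ => 1 + z ^ 2) z := by fun_prop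
    have hroot := (differentiableAt_csqrt (one_add_sq_mem_slitPlane hz)).comp z hsq
    exact (differentiableAt_id.add hroot).differentiableWithinAt
  map_zero := by simp [psiCrescent, csqrt_one]
  re_pos := fun z hz => by
    have hlt : |z.re| < (csqrt (1 + z ^ 2)).re := by
      refine abs_lt_of_sq_lt_sq ?_ (re_csqrt_nonneg _)
      have hsq := congrArg re (csqrt_sq (1 + z ^ 2))
      rw [sq, sq z, mul_re, add_re, one_re, mul_re, ← sq z] at hsq
      nlinarith [re_sq_add_im_sq_lt (mem_unitDisk.1 hz), sq_nonneg z.re,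
        sq_nonneg (csqrt (1 + z ^ 2)).im]
    rw [psiCrescent, add_re]
    linarith [neg_abs_le z.re]

/-- The hypothesis bounds the Joukowski-type quotient `(w - 1 / w) / 2`, which inverts
`psiCrescent`. -/
lemma half_lt_re_and_norm_sub_one_le {w : ℂ} (hw : 0 < w.re)
    (h : ‖w ^ 2 - 1‖ < 3 / 2 * ‖w‖) : 1 / 2 < w.re ∧ ‖w - 1‖ ≤ 1 := by
  obtain ⟨m, hm⟩ : ∃ m, m = w.re ^ 2 + w.im ^ 2 := ⟨_, rfl⟩
  have hxm : w.re ^ 2 ≤ m := by linarith [sq_nonneg w.im]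
  have hbound : m ^ 2 - m / 4 + 1 < 4 * w.re ^ 2 := by
    have hsq := pow_lt_pow_left₀ h (norm_nonneg _) two_ne_zero
    rw [mul_pow, sq_norm_eq, sq_norm_eq, sq w, sub_re, sub_im, mul_re, mul_im, one_re, one_im,
      ← hm] at hsq
    rw [hm] at hsq ⊢
    linarith
  have hm1 : 1 / 4 < m := by nlinarith [hxm]
  have hm2 : m ≤ 2 * w.re := by
    refine le_of_sq_le_sq ?_ (by linarith)
    nlinarith
  refine ⟨by nlinarith, (sq_le_one_iff₀ (norm_nonneg _)).1 ?_⟩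
  rw [sq_norm_eq, sub_re, sub_im, one_re, one_im]
  linarith

theorem isSharpRadius_psiCrescent :
    IsSharpRadius starCar (starClass psiCrescent) (3 / 4) := by
  have hmem : ∀ z : ℂ, ‖z‖ < 3 / 4 →
      1 / 2 < (psiCrescent z).re ∧ ‖psiCrescent z - 1‖ ≤ 1 := fun z hz => by
    have hw := isCaratheodory_psiCrescent.re_pos z (mem_unitDisk.2 (by linarith))
    refine half_lt_re_and_norm_sub_one_le hw ?_
    rw [psiCrescent_sq_sub_one, norm_mul, norm_mul, norm_ofNat]
    nlinarith [hw.trans_le (re_le_norm _)]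
  refine isSharpRadius_starCar_of_half_lt_re isCaratheodory_psiCrescent (by norm_num)
    (by norm_num) (fun z hz => (hmem z hz).1) (fun z hz => (hmem z hz).2) ?_
  have hval : 1 + (-((3 / 4 : ℝ) : ℂ)) ^ 2 = ((5 / 4 : ℝ) : ℂ) ^ 2 := by
    push_cast
    norm_num
  rw [psiCrescent, hval, csqrt_ofReal_sq (by norm_num)]
  push_cast
  norm_num

/-! ### Classes given by polynomials -/

section Quadratic

variable {a b R : ℝ}

lemma re_quadratic (z : ℂ) :
    (1 + a * z + b * z ^ 2).re = 1 + a * z.re + b * (z.re ^ 2 - z.im ^ 2) := by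
  rw [add_re, add_re, one_re, re_ofReal_mul, re_ofReal_mul, sq, mul_re]
  ring

lemma isCaratheodory_quadratic (hb : 0 < b) (hab : a ^ 2 ≤ 8 * b * (1 - b)) :
    IsCaratheodory fun z => 1 + a * z + b * z ^ 2 where
  differentiableOn := by fun_prop
  map_zero := by simp
  re_pos := fun z hz => by
    have hsq := re_sq_add_im_sq_lt (mem_unitDisk.1 hz)
    have hdiscrim : 0 ≤ 8 * b * (1 + a * z.re + b * (2 * z.re ^ 2 - 1)) := by
      linarith [sq_nonneg (4 * b * z.re + a)]
    rw [re_quadratic]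
    nlinarith [nonneg_of_mul_nonneg_right hdiscrim (by linarith)]

lemma lt_re_quadratic (hb : 0 < b) (hbR : 4 * b * R ≤ a) {z : ℂ} (hz : ‖z‖ < R) :
    1 - a * R + b * R ^ 2 < (1 + a * z + b * z ^ 2).re := by
  have hx := (abs_le.1 (abs_re_le_norm z)).1
  have hline : 1 - a * R + b * R ^ 2 ≤ 1 + a * z.re + b * (2 * z.re ^ 2 - R ^ 2) := by
    nlinarith [mul_nonneg (by linarith : 0 ≤ R + z.re) hb.le]
  rw [re_quadratic]
  nlinarith [re_sq_add_im_sq_lt hz]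

theorem isSharpRadius_quadratic (hb : 0 < b) (hab : a ^ 2 ≤ 8 * b * (1 - b)) (hR0 : 0 < R)
    (hR1 : R ≤ 1) (hbR : 4 * b * R ≤ a) (hcusp : a * R - b * R ^ 2 = 1 / 2) :
    IsSharpRadius starCar (starClass fun z => 1 + a * z + b * z ^ 2) R := by
  have ha : 0 ≤ a := le_trans (by positivity) hbR
  refine isSharpRadius_starCar_of_half_lt_re (isCaratheodory_quadratic hb hab) hR0 hR1
    (fun z hz => ?_) (fun z hz => ?_) ?_
  · linarith [lt_re_quadratic hb hbR hz]
  · calc ‖1 + a * z + b * z ^ 2 - 1‖ = ‖a * z + b * z ^ 2‖ := by ring_nf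
      _ ≤ a * ‖z‖ + b * ‖z‖ ^ 2 := by
        refine (norm_add_le _ _).trans_eq ?_
        rw [norm_mul, norm_mul, norm_pow, norm_real, norm_real, Real.norm_of_nonneg ha,
          Real.norm_of_nonneg hb.le]
      _ ≤ a * R + b * R ^ 2 := by gcongr
      _ ≤ 1 := by nlinarith
  · have hcuspℂ : (a * R - b * R ^ 2 : ℂ) = 1 / 2 := by
      simpa using congrArg ofReal hcusp
    linear_combination -hcuspℂ

end Quadratic

theorem isSharpRadius_psiC : IsSharpRadius starCar (starClass psiC) (1 / 2) := by
  have hψ : psiC = fun z : ℂ => 1 + (4 / 3 : ℝ) * z + (2 / 3 : ℝ) * z ^ 2 := by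
    funext z
    unfold psiC
    push_cast
    ring
  rw [hψ]
  exact isSharpRadius_quadratic (by norm_num) (by norm_num) (by norm_num) (by norm_num)
    (by norm_num) (by norm_num)

theorem isSharpRadius_psiLim : IsSharpRadius starCar (starClass psiLim) (√2 - 1) := by
  obtain ⟨hlo, hhi⟩ := sqrt_two_mem_Ioo
  have hψ : psiLim = fun z : ℂ => 1 + (√2 : ℝ) * z + (1 / 2 : ℝ) * z ^ 2 := by
    funext z
    unfold psiLim
    push_cast
    ring
  rw [hψ]
  exact isSharpRadius_quadratic (by norm_num) (by linarith [sq_sqrt_two]) (by linarith)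
    (by linarith) (by linarith) (by linear_combination sq_sqrt_two / 2)

lemma re_psiNe (z : ℂ) : (psiNe z).re = 1 + z.re * (1 + z.im ^ 2) - z.re ^ 3 / 3 := by
  rw [psiNe, sub_re, add_re, one_re, div_ofNat_re]
  simp only [pow_succ, pow_zero, one_mul, mul_re, mul_im]
  ring

lemma isCaratheodory_psiNe : IsCaratheodory psiNe where
  differentiableOn := by
    unfold psiNe
    fun_prop
  map_zero := by simp [psiNe]
  re_pos := fun z hz => by
    have hsq := re_sq_add_im_sq_lt (mem_unitDisk.1 hz)
    have hx := abs_le.1 ((abs_re_le_norm z).trans (mem_unitDisk.1 hz).le)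
    rw [re_psiNe]
    rcases le_total 0 z.re with h0 | h0
    · nlinarith [mul_nonneg h0 (sq_nonneg z.im)]
    · have hcubic : 0 < 1 + 2 * z.re - 4 / 3 * z.re ^ 3 := by
        nlinarith [mul_nonneg (sq_nonneg (z.re + 0.7)) (neg_nonneg.2 h0),
          sq_nonneg (z.re + 0.7)]
      nlinarith

lemma lt_re_psiNe {z : ℂ} {R : ℝ} (hR : 3 * R ^ 2 ≤ 1) (hz : ‖z‖ < R) :
    1 - R + R ^ 3 / 3 < (psiNe z).re := by
  have hsq := re_sq_add_im_sq_lt hz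
  have hx := abs_lt.1 ((abs_re_le_norm z).trans_lt hz)
  rw [re_psiNe]
  rcases le_total 0 z.re with h0 | h0
  · nlinarith [mul_nonneg h0 (sq_nonneg z.im)]
  · have hfactor : 0 < (R + z.re) * (1 + R ^ 2 - 4 / 3 * (R ^ 2 - R * z.re + z.re ^ 2)) :=
      mul_pos (by linarith) (by nlinarith)
    nlinarith

theorem isSharpRadius_psiNe {R : ℝ} (hR0 : 0 < R) (hR : 3 * R ^ 2 ≤ 1)
    (hroot : 2 * R ^ 3 - 6 * R + 3 = 0) : IsSharpRadius starCar (starClass psiNe) R := by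
  have hR1 : R < 2 / 3 := by nlinarith
  refine isSharpRadius_starCar_of_half_lt_re isCaratheodory_psiNe hR0 (by linarith)
    (fun z hz => ?_) (fun z hz => ?_) ?_
  · linarith [lt_re_psiNe hR hz]
  · have hcube : ‖z‖ ^ 3 ≤ 1 := pow_le_one₀ (norm_nonneg z) (by linarith)
    calc ‖psiNe z - 1‖ = ‖z - z ^ 3 / 3‖ := by rw [psiNe, add_sub_assoc, add_sub_cancel_left]
      _ ≤ ‖z‖ + ‖z‖ ^ 3 / 3 := (norm_sub_le _ _).trans_eq (by rw [norm_div, norm_pow, norm_ofNat])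
      _ ≤ 1 := by linarith
  · have hrootℂ : 2 * (R : ℂ) ^ 3 - 6 * R + 3 = 0 := by exact_mod_cast hroot
    unfold psiNe
    linear_combination hrootℂ / 6

lemma exists_isLeast_cubic_root :
    ∃ r : ℝ, IsLeast {r : ℝ | 0 < r ∧ r < 1 ∧ 2 * r ^ 3 - 6 * r + 3 = 0} r ∧
      |r - 0.557875| < 0.000001 := by
  have hcont : ContinuousOn (fun r : ℝ => 2 * r ^ 3 - 6 * r + 3) (Icc 0.5578745 0.5578755) := by
    fun_prop
  obtain ⟨r, ⟨hlo, hhi⟩, hr⟩ := intermediate_value_Icc' (by norm_num) hcont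
    (show (0 : ℝ) ∈ Icc _ _ by constructor <;> norm_num)
  refine ⟨r, ⟨⟨by linarith, by linarith, hr⟩, fun s ⟨hs0, hs1, hs⟩ => ?_⟩,
    abs_lt.2 ⟨by linarith, by linarith⟩⟩
  by_contra! hlt
  have hfactor : (r - s) * (r ^ 2 + r * s + s ^ 2 - 3) = 0 := by
    linear_combination (hr - hs) / 2
  rcases mul_eq_zero.1 hfactor with h | h <;> nlinarith

/-! ### The sine class -/

lemma re_sin (z : ℂ) : (sin z).re = Real.sin z.re * Real.cosh z.im := by
  rw [sin_eq, add_re, ← ofReal_sin, ← ofReal_cosh, ← ofReal_cos, ← ofReal_sinh, ← ofReal_mul,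
    ← ofReal_mul, ofReal_re, re_ofReal_mul, I_re, mul_zero, add_zero]

lemma abs_re_sin_le (z : ℂ) : |(sin z).re| ≤ |Real.sin z.re| * Real.exp (z.im ^ 2 / 2) := by
  rw [re_sin, abs_mul, abs_of_pos (Real.cosh_pos _)]
  exact mul_le_mul_of_nonneg_left (Real.cosh_le_exp_half_sq _) (abs_nonneg _)

lemma abs_re_sin_lt_one {z : ℂ} (hz : ‖z‖ < 1) : |(sin z).re| < 1 := by
  have hexp : z.re ^ 2 * Real.exp (z.im ^ 2) < 1 := by
    have hlt : z.re ^ 2 < Real.exp (-z.im ^ 2) := by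
      linarith [re_sq_add_im_sq_lt hz, Real.add_one_le_exp (-z.im ^ 2)]
    calc z.re ^ 2 * Real.exp (z.im ^ 2) < Real.exp (-z.im ^ 2) * Real.exp (z.im ^ 2) := by gcongr
      _ = 1 := by rw [← Real.exp_add, neg_add_cancel, Real.exp_zero]
  refine (abs_re_sin_le z).trans_lt (lt_of_pow_lt_pow_left₀ 2 zero_le_one ?_)
  calc (|Real.sin z.re| * Real.exp (z.im ^ 2 / 2)) ^ 2
      ≤ (|z.re| * Real.exp (z.im ^ 2 / 2)) ^ 2 := pow_le_pow_left₀ (by positivity)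
        (mul_le_mul_of_nonneg_right Real.abs_sin_le_abs (Real.exp_pos _).le) 2
    _ = z.re ^ 2 * Real.exp (z.im ^ 2) := by
        rw [mul_pow, sq_abs, ← Real.exp_nat_mul, Nat.cast_ofNat, mul_div_cancel₀ _ two_ne_zero]
    _ < 1 ^ 2 := by rwa [one_pow]

lemma strictMonoOn_sin_mul_exp_neg_sq :
    StrictMonoOn (fun x => Real.sin x * Real.exp (-(x ^ 2 / 2))) (Icc 0 (4 / 5)) := by
  have hderiv (x : ℝ) : HasDerivAt (fun x => Real.sin x * Real.exp (-(x ^ 2 / 2)))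
      ((Real.cos x - x * Real.sin x) * Real.exp (-(x ^ 2 / 2))) x := by
    have hsq : HasDerivAt (fun x : ℝ => -(x ^ 2 / 2)) (-x) x :=
      (((hasDerivAt_pow 2 x).div_const 2).neg).congr_deriv (by norm_num)
    exact ((Real.hasDerivAt_sin x).mul hsq.exp).congr_deriv (by ring)
  refine strictMonoOn_of_deriv_pos (convex_Icc _ _)
    (fun x _ => (hderiv x).continuousAt.continuousWithinAt) fun x hx => ?_
  rw [interior_Icc] at hx
  rw [(hderiv x).deriv]
  have hcos := Real.one_sub_sq_div_two_le_cos (x := x)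
  have hsin := Real.sin_le hx.1.le
  exact mul_pos (by nlinarith [hx.1, hx.2]) (Real.exp_pos _)

lemma abs_re_sin_lt_sin {z : ℂ} {R : ℝ} (hR : R ≤ 4 / 5) (hz : ‖z‖ < R) :
    |(sin z).re| < Real.sin R := by
  have hx : |z.re| < R := (abs_re_le_norm z).trans_lt hz
  have hsin : |Real.sin z.re| = Real.sin |z.re| :=
    Real.abs_sin_eq_sin_abs_of_abs_le_pi (by linarith [Real.pi_gt_three])
  have hy : z.im ^ 2 ≤ R ^ 2 - |z.re| ^ 2 := by
    rw [sq_abs]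
    linarith [re_sq_add_im_sq_lt hz]
  calc |(sin z).re| ≤ |Real.sin z.re| * Real.exp (z.im ^ 2 / 2) := abs_re_sin_le z
    _ ≤ |Real.sin z.re| * Real.exp ((R ^ 2 - |z.re| ^ 2) / 2) := by gcongr
    _ = Real.sin |z.re| * Real.exp (-(|z.re| ^ 2 / 2)) * Real.exp (R ^ 2 / 2) := by
        rw [hsin, mul_assoc, ← Real.exp_add]
        ring_nf
    _ < Real.sin R * Real.exp (-(R ^ 2 / 2)) * Real.exp (R ^ 2 / 2) := by
        have hmono := strictMonoOn_sin_mul_exp_neg_sq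
          ⟨abs_nonneg _, hx.le.trans hR⟩ ⟨(abs_nonneg _).trans hx.le, hR⟩ hx
        exact mul_lt_mul_of_pos_right hmono (Real.exp_pos _)
    _ = Real.sin R := by rw [mul_assoc, ← Real.exp_add, neg_add_cancel, Real.exp_zero, mul_one]

lemma norm_sin_le {z : ℂ} (hz : ‖z‖ ≤ 1) : ‖sin z‖ ≤ ‖z‖ + ‖z‖ ^ 2 := by
  have hneg := norm_exp_sub_one_sub_id_le (x := -z * I) (by simpa using hz)
  have hpos := norm_exp_sub_one_sub_id_le (x := z * I) (by simpa using hz)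
  rw [norm_mul, norm_I, mul_one] at hneg hpos
  rw [norm_neg] at hneg
  have hsin : sin z - z =
      ((exp (-z * I) - 1 - -z * I) - (exp (z * I) - 1 - z * I)) * I / 2 := by
    rw [sin]
    linear_combination -z * I_sq
  have hsub : ‖sin z - z‖ ≤ ‖z‖ ^ 2 := by
    rw [hsin, norm_div, norm_mul, norm_I, mul_one, norm_ofNat, div_le_iff₀ two_pos]
    linarith [norm_sub_le (exp (-z * I) - 1 - -z * I) (exp (z * I) - 1 - z * I)]
  linarith [norm_sub_norm_le (sin z) z]

lemma isCaratheodory_psiSin : IsCaratheodory psiSin where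
  differentiableOn := (differentiable_sin.const_add 1).differentiableOn
  map_zero := by simp [psiSin]
  re_pos := fun z hz => by
    rw [psiSin, add_re, one_re]
    linarith [(abs_lt.1 (abs_re_sin_lt_one (mem_unitDisk.1 hz))).1]

theorem isSharpRadius_psiSin :
    IsSharpRadius starCar (starClass psiSin) (Real.arcsin (1 / 2)) := by
  have hsin : Real.sin (Real.arcsin (1 / 2)) = 1 / 2 :=
    Real.sin_arcsin (by norm_num) (by norm_num)
  have hR : Real.arcsin (1 / 2) < 3 / 5 := by
    have harcsin : Real.arcsin (1 / 2) = Real.pi / 6 :=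
      Real.arcsin_eq_of_sin_eq Real.sin_pi_div_six
        ⟨by linarith [Real.pi_pos], by linarith [Real.pi_pos]⟩
    linarith [Real.pi_lt_d2]
  refine isSharpRadius_starCar_of_half_lt_re isCaratheodory_psiSin
    (Real.arcsin_pos.2 (by norm_num)) (by linarith) (fun z hz => ?_) (fun z hz => ?_) ?_
  · have hre := abs_re_sin_lt_sin (by linarith) hz
    rw [hsin] at hre
    rw [psiSin, add_re, one_re]
    linarith [(abs_lt.1 hre).1]
  · rw [psiSin, add_sub_cancel_left]
    refine (norm_sin_le (by linarith)).trans ?_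
    nlinarith [norm_nonneg z]
  · rw [psiSin, sin_neg, ← ofReal_sin, hsin]
    push_cast
    norm_num

/-! ### The exponential class -/

lemma strictConcaveOn_sq_sub_exp_sub_mul_exp_neg {κ : ℝ} (hκ : 1 < κ) :
    StrictConcaveOn ℝ univ fun s => s ^ 2 - Real.exp s - κ * Real.exp (-s) := by
  have hderiv (s : ℝ) : HasDerivAt (fun s => s ^ 2 - Real.exp s - κ * Real.exp (-s))
      (2 * s - Real.exp s + κ * Real.exp (-s)) s :=
    (((hasDerivAt_pow 2 s).sub (Real.hasDerivAt_exp s)).sub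
      ((hasDerivAt_neg s).exp.const_mul κ)).congr_deriv (by norm_num)
  have hderiv2 (s : ℝ) : HasDerivAt (fun s => 2 * s - Real.exp s + κ * Real.exp (-s))
      (2 - Real.exp s - κ * Real.exp (-s)) s :=
    ((((hasDerivAt_id s).const_mul 2).sub (Real.hasDerivAt_exp s)).add
      ((hasDerivAt_neg s).exp.const_mul κ)).congr_deriv (by ring)
  refine strictConcaveOn_univ_of_deriv2_neg
    (continuous_iff_continuousAt.2 fun s => (hderiv s).continuousAt) fun s => ?_
  rw [Function.iterate_succ, Function.iterate_one, Function.comp_apply,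
    funext fun s => (hderiv s).deriv, (hderiv2 s).deriv]
  have hcosh := Real.one_le_cosh s
  rw [Real.cosh_eq] at hcosh
  nlinarith [Real.exp_pos (-s)]

/-- The difference of the two sides is a strictly concave function of `s`. It vanishes at `-R` and
takes the value `(1 - t) ^ 2 * (1 + t) * (3 * t - 1) / t > 0` at `R`. -/
lemma exp_add_mul_exp_neg_lt {R s t : ℝ} (ht : t = Real.exp (-R)) (hR : Real.exp R < 3)
    (hs : |s| < R) :
    Real.exp s + (4 * t - 3 * t ^ 2) * Real.exp (-s) < 4 - 2 * t - R ^ 2 + s ^ 2 := by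
  obtain ⟨hs1, hs2⟩ := abs_lt.1 hs
  have hR0 : 0 < R := (abs_nonneg s).trans_lt hs
  have htu : t * Real.exp R = 1 := by rw [ht, ← Real.exp_add, neg_add_cancel, Real.exp_zero]
  have hu : 1 < Real.exp R := Real.one_lt_exp_iff.2 hR0
  have ht0 : 0 < t := ht ▸ Real.exp_pos _
  have ht1 : t < 1 := by nlinarith
  have ht3 : 1 < 3 * t := by nlinarith
  have hconcave := strictConcaveOn_sq_sub_exp_sub_mul_exp_neg (κ := 4 * t - 3 * t ^ 2)
    (by nlinarith)
  have hmin := hconcave.lt_on_openSegment (mem_univ (-R)) (mem_univ R) (by linarith) (z := s)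
    (by rw [openSegment_eq_Ioo (by linarith)]; exact ⟨hs1, hs2⟩)
  have hleft : (-R) ^ 2 - Real.exp (-R) - (4 * t - 3 * t ^ 2) * Real.exp (- -R) =
      R ^ 2 + 2 * t - 4 := by
    rw [neg_neg, ← ht]
    linear_combination (3 * t - 4) * htu
  have hright : R ^ 2 + 2 * t - 4 < R ^ 2 - Real.exp R - (4 * t - 3 * t ^ 2) * Real.exp (-R) := by
    have hpos : 0 < Real.exp R * ((1 - t) ^ 2 * (1 + t) * (3 * t - 1)) := by
      have := sub_pos.2 ht1
      have := sub_pos.2 ht3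
      positivity
    rw [← ht]
    linear_combination hpos + (4 - 2 * t - 4 * t ^ 2 + 3 * t ^ 3) * htu
  rw [min_eq_left (hleft.trans_lt hright).le, hleft] at hmin
  linarith

lemma re_exp_ge (z : ℂ) : Real.exp z.re * (1 - z.im ^ 2 / 2) ≤ (exp z).re := by
  rw [exp_re]
  exact mul_le_mul_of_nonneg_left Real.one_sub_sq_div_two_le_cos (Real.exp_pos _).le

lemma norm_exp_sub_sq_lt {z : ℂ} {R t : ℝ} (ht : t = Real.exp (-R)) (hR : Real.exp R < 3)
    (hz : ‖z‖ < R) : ‖exp z - t‖ ^ 2 < 2 * (1 - t) * (‖exp z - t‖ + (exp z - t).re) := by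
  have hR0 : 0 < R := (norm_nonneg z).trans_lt hz
  have ht0 : 0 < t := ht ▸ Real.exp_pos _
  have ht1 : t < 1 := ht ▸ Real.exp_lt_one_iff.2 (neg_lt_zero.2 hR0)
  set E := Real.exp z.re with hE
  have hE0 : 0 < E := Real.exp_pos _
  have hnorm : E - t ≤ ‖exp z - t‖ := by
    have := norm_sub_norm_le (exp z) t
    rwa [norm_exp, norm_real, Real.norm_of_nonneg ht0.le] at this
  have hexpand : ‖exp z - t‖ ^ 2 = E ^ 2 - 2 * t * (exp z).re + t ^ 2 := by
    rw [hE, ← norm_exp, sq_norm_eq, sq_norm_eq, sub_re, sub_im, ofReal_re, ofReal_im]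
    ring
  have hreal : E ^ 2 + (4 * t - 3 * t ^ 2) < E * (4 - 2 * t - (R ^ 2 - z.re ^ 2)) := by
    have hlt := exp_add_mul_exp_neg_lt ht hR ((abs_re_le_norm z).trans_lt hz)
    have hinv : E * Real.exp (-z.re) = 1 := by
      rw [hE, ← Real.exp_add, add_neg_cancel, Real.exp_zero]
    calc E ^ 2 + (4 * t - 3 * t ^ 2)
        = E * (E + (4 * t - 3 * t ^ 2) * Real.exp (-z.re)) := by
          linear_combination -(4 * t - 3 * t ^ 2) * hinv
      _ < E * (4 - 2 * t - (R ^ 2 - z.re ^ 2)) := mul_lt_mul_of_pos_left (by linarith) hE0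
  have hcos : E * (2 - (R ^ 2 - z.re ^ 2)) ≤ 2 * (exp z).re := by
    have him := mul_le_mul_of_nonneg_left (re_sq_add_im_sq_lt hz).le hE0.le
    linarith [re_exp_ge z]
  rw [hexpand, sub_re, ofReal_re]
  nlinarith [mul_le_mul_of_nonneg_left hnorm (sub_pos.2 ht1).le]

lemma psiE_mem_image_phiCar {α R : ℝ} {z : ℂ} (hα : 2 * (1 - α) * (1 - Real.exp (-R)) = 1)
    (hR : Real.exp R < 3) (hz : ‖z‖ < R) : psiE α z ∈ phiCar '' unitDisk := by
  apply mem_image_phiCar_of_norm_sq_lt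
  obtain ⟨t, ht⟩ : ∃ t, t = Real.exp (-R) := ⟨_, rfl⟩
  have hR0 : 0 < R := (norm_nonneg z).trans_lt hz
  have ht1 : 0 < 1 - t := by
    rw [ht]
    exact sub_pos.2 (Real.exp_lt_one_iff.2 (neg_lt_zero.2 hR0))
  rw [← ht] at hα
  have hscale : exp z - t = (1 - t : ℝ) * (2 * psiE α z - 1) := by
    have hαℂ : (2 * (1 - α) * (1 - t) : ℂ) = 1 := by exact_mod_cast hα
    unfold psiE
    push_cast
    linear_combination (1 - exp z) * hαℂ
  have hlt := norm_exp_sub_sq_lt ht hR hz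
  rw [hscale, norm_mul, norm_real, Real.norm_of_nonneg ht1.le, re_ofReal_mul] at hlt
  refine lt_of_mul_lt_mul_left ?_ (sq_nonneg (1 - t))
  linarith

lemma isCaratheodory_psiE {α : ℝ} (hα0 : 0 ≤ α) (hα1 : α < 1) : IsCaratheodory (psiE α) where
  differentiableOn := ((differentiable_exp.const_mul _).const_add _).differentiableOn
  map_zero := by simp [psiE]
  re_pos := fun z hz => by
    have hexp : 0 < (exp z).re := by
      refine lt_of_lt_of_le (mul_pos (Real.exp_pos _) ?_) (re_exp_ge z)
      nlinarith [re_sq_add_im_sq_lt (mem_unitDisk.1 hz)]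
    rw [psiE, add_re, ofReal_re, ← ofReal_one, ← ofReal_sub, re_ofReal_mul]
    exact add_pos_of_nonneg_of_pos hα0 (mul_pos (sub_pos.2 hα1) hexp)

theorem isSharpRadius_psiE {α : ℝ} (hα0 : 0 ≤ α)
    (hα : α < (Real.exp 1 - 2) / (2 * (Real.exp 1 - 1))) :
    IsSharpRadius starCar (starClass (psiE α)) (Real.log (2 * (1 - α) / (1 - 2 * α))) := by
  have he : 2 < Real.exp 1 := by linarith [Real.exp_one_gt_d9]
  rw [lt_div_iff₀ (by linarith)] at hα
  have hα2 : 0 < 1 - 2 * α := by nlinarith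
  have hα1 : 0 < 1 - α := by linarith
  obtain ⟨R, hR⟩ : ∃ R, R = Real.log (2 * (1 - α) / (1 - 2 * α)) := ⟨_, rfl⟩
  rw [← hR]
  have hexpR : Real.exp R = 2 * (1 - α) / (1 - 2 * α) := by
    rw [hR, Real.exp_log (by positivity)]
  have hR0 : 0 < R := by
    rw [← Real.one_lt_exp_iff, hexpR, one_lt_div hα2]
    linarith
  have hR1 : R < 1 := by
    rw [← Real.exp_lt_exp, hexpR, div_lt_iff₀ hα2]
    linarith
  have hexp3 : Real.exp R < 3 := (Real.exp_lt_exp.2 hR1).trans Real.exp_one_lt_three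
  have hcusp : 2 * (1 - α) * (1 - Real.exp (-R)) = 1 := by
    rw [Real.exp_neg, hexpR]
    field_simp
    ring
  refine isSharpRadius_starCar (isCaratheodory_psiE hα0 (by linarith)) hR0 hR1.le
    (fun z hz => psiE_mem_image_phiCar hcusp hexp3 hz) ?_
  have hcuspℂ : (2 * (1 - α) * (1 - exp (-R)) : ℂ) = 1 := by exact_mod_cast hcusp
  unfold psiE
  linear_combination -hcuspℂ / 2

end CarRadius

theorem theorem4p3 :
    (∀ c : ℝ, 3 / 4 < c → c ≤ 1 →
      CarRadius.IsSharpRadius CarRadius.starCar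
        (CarRadius.starClass (CarRadius.psiCassini c)) (3 / (4 * c))) ∧
    (∀ α : ℝ, 0 ≤ α → α < 1 / 2 →
      CarRadius.IsSharpRadius CarRadius.starCar
        (CarRadius.starClass (CarRadius.psiL α)) ((3 - 4 * α) / (4 * (1 - α) ^ 2))) ∧
    (∀ α : ℝ, 0 ≤ α → α < (Real.exp 1 - 2) / (2 * (Real.exp 1 - 1)) →
      CarRadius.IsSharpRadius CarRadius.starCar
        (CarRadius.starClass (CarRadius.psiE α))
        (Real.log (2 * (1 - α) / (1 - 2 * α)))) ∧
    CarRadius.IsSharpRadius CarRadius.starCar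
      (CarRadius.starClass CarRadius.psiRL) ((39 + 17 * √2) / 82) ∧
    CarRadius.IsSharpRadius CarRadius.starCar
      (CarRadius.starClass CarRadius.psiC) (1 / 2) ∧
    CarRadius.IsSharpRadius CarRadius.starCar
      (CarRadius.starClass CarRadius.psiLim) (√2 - 1) ∧
    CarRadius.IsSharpRadius CarRadius.starCar
      (CarRadius.starClass CarRadius.psiCrescent) (3 / 4) ∧
    CarRadius.IsSharpRadius CarRadius.starCar
      (CarRadius.starClass CarRadius.psiSin) (Real.arcsin (1 / 2)) ∧
    (∃ r₉ : ℝ, IsLeast {r : ℝ | 0 < r ∧ r < 1 ∧ 2 * r ^ 3 - 6 * r + 3 = 0} r₉ ∧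
      |r₉ - 0.557875| < 0.000001 ∧
      CarRadius.IsSharpRadius CarRadius.starCar
        (CarRadius.starClass CarRadius.psiNe) r₉) := by
  obtain ⟨r, hr, hr'⟩ := CarRadius.exists_isLeast_cubic_root
  exact ⟨fun _ => CarRadius.isSharpRadius_psiCassini, fun _ => CarRadius.isSharpRadius_psiL,
    fun _ => CarRadius.isSharpRadius_psiE, CarRadius.isSharpRadius_psiRL,
    CarRadius.isSharpRadius_psiC, CarRadius.isSharpRadius_psiLim,
    CarRadius.isSharpRadius_psiCrescent, CarRadius.isSharpRadius_psiSin, r, hr, hr',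
    CarRadius.isSharpRadius_psiNe hr.1.1 (by nlinarith [hr.1.1, (abs_lt.1 hr').2]) hr.1.2.2⟩
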